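/- **Setting.** Identify $x=(x_0,x_1,x_2,x_3)\in\mathbb R^4$ with the quaternion $x=x_0+\vec q$, $\vec q=x_1\mathbf e_1+x_2\mathbf e_2+x_3\mathbf e_3$, and let $\mathbb H^*=\{x\in\mathbb H:\vec q\ne0\}$. Let $V_q=\frac{\partial}{\partial x_0}-\frac1{\vec q}\sum_{u=1}^3x_u\frac{\partial}{\partial x_u}$; a $C^1$ function $f$ on an open set is $V_q$-regular if $V_qf=0$ there (for matrix-valued functions: entrywise). Put $\mu_u(x)=x_u\left(1+\frac{x_0}{\vec q}\right)$ for $u=1,2,3$, $\mu(x)=\begin{pmatrix}\mu_1(x)&\mu_2(x)&\mu_3(x)\end{pmatrix}$, and $\mu^\alpha=\mu_1^{\alpha_1}\mu_2^{\alpha_2}\mu_3^{\alpha_3}$ for $\alpha\in\mathbb N_0^3$. Let $$\Omega_A=\Big\{x\in\mathbb H^*:\sum_{\alpha\in\mathbb N_0^3}\tfrac{|\alpha|!}{\alpha!}|\mu^\alpha(x)|^2<\infty\Big\},\qquad \Omega_1(\mathfrak A)=\Big\{x\in\mathbb H^*:\sum_{u=1}^3|\mu_u(x)|^2<1\Big\}.$$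 The Arveson space $\mathfrak A$ consists of the functions $f(x)=\sum_\alpha\mu^\alpha(x)c_\alpha$, $c_\alpha\in\mathbb H$, the series converging absolutely on $\Omega_A$, with $\|f\|^2=\sum_\alpha\frac{\alpha!}{|\alpha|!}|c_\alpha|^2<\infty$. The space $\mathfrak A^m$ consists of columns of $m$ elements of $\mathfrak A$, with $\|f\|^2=\sum_i\|f_i\|^2$. For $V_q$-regular matrix functions $F,G$ on $\Omega_A$ of compatible sizes, $F\star G$ is the $V_q$-regular function on $\Omega_A$ (when it exists) whose restriction to $\{x_0=0\}$ is the pointwise product of the restrictions of $F$ and $G$; $F^{-\star}$ is the inverse for $\star$. An $\mathbb H^{n\times m}$-valued function $S$ on $\Omega_A$ is a Schur multiplier from $\mathfrak A^m$ into $\mathfrak A^n$ if $f\mapsto S\star f$ maps $\mathfrak A^m$ into $\mathfrak A^n$ with operator norm at most $1$. **Theorem.** Let $a\in\Omega_1(\mathfrak A)$. Then: 1. Left multiplication by the constant row $\mu(a)$, $f\mapsto\mu(a)\star f$, is a strict contraction (operator norm $<1$) from $\mathfrak A^3$ into $\mathfrak A$. 2. The $\mathbb H^{1\times3}$-valued function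 $$B_a(x)=(1-\mu(a)\mu(a)^*)^{1/2}\,\big(1-\mu(x)\mu(a)^*\big)^{-\star}\star\big(\mu(x)-\mu(a)\big)\,\big(I_3-\mu(a)^*\mu(a)\big)^{-1/2}$$ exists on $\Omega_A$ (that is, the matrices $1-\mu(a)\mu(a)^*$ and $I_3-\mu(a)^*\mu(a)$ are positive definite, and the $\star$-inverse and the $\star$-product exist on $\Omega_A$), and it is a Schur multiplier from $\mathfrak A^3$ into $\mathfrak A$. -/

import Mathlib

namespace VqArveson

noncomputable section

open Matrix

/-- The real quaternions; `x = x₀ + x₁ i + x₂ j + x₃ k` is identified with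
`(x₀, x₁, x₂, x₃) ∈ ℝ⁴`. -/
abbrev H : Type := Quaternion ℝ

/-- The imaginary units `i, j, k`. -/
def unit : Fin 3 → H := ![⟨0, 1, 0, 0⟩, ⟨0, 0, 1, 0⟩, ⟨0, 0, 0, 1⟩]

/-- The three vector coordinates `x₁, x₂, x₃` of a quaternion. -/
def coord (u : Fin 3) (x : H) : ℝ := ![x.imI, x.imJ, x.imK] u

/-- `ℍ*`: the quaternions with nonzero vector part. -/
def Hstar : Set H := {x | x.im ≠ 0}

/-- `V_q f = ∂f/∂x₀ - (1/q⃗) ∑ᵤ xᵤ ∂f/∂xᵤ` at the point `x`. -/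
def Vq (f : H → H) (x : H) : H :=
  fderiv ℝ f x 1 - (x.im)⁻¹ * ∑ u : Fin 3, coord u x • fderiv ℝ f x (unit u)

/-- `f` is of class `C¹` and satisfies `V_q f = 0` on the (open) set `Ω`. -/
def VqRegularOn (f : H → H) (Ω : Set H) : Prop :=
  ContDiffOn ℝ 1 f Ω ∧ ∀ x ∈ Ω, Vq f x = 0

/-- Matrix-valued `V_q`-regular functions. -/
def MatVqRegularOn {n m : ℕ} (F : H → Matrix (Fin n) (Fin m) H) (Ω : Set H) : Prop :=
  ∀ i j, VqRegularOn (fun x => F x i j) Ω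

/-- The `V_q`-Fueter variables `μᵤ(x) = xᵤ (1 + x₀ / q⃗)`. -/
def mu (u : Fin 3) (x : H) : H :=
  (coord u x : H) * (1 + (x.re : H) * (x.im)⁻¹)

/-- The monomials `μ^α(x) = μ₁(x)^α₁ μ₂(x)^α₂ μ₃(x)^α₃`. -/
def muPow (α : Fin 3 → ℕ) (x : H) : H :=
  mu 0 x ^ α 0 * mu 1 x ^ α 1 * mu 2 x ^ α 2

/-- The row vector `μ(x) = (μ₁(x), μ₂(x), μ₃(x))`. -/
def muRow (x : H) : Matrix (Fin 1) (Fin 3) H := Matrix.of fun _ u => mu u x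

/-- The weight `α! / |α|!`. -/
def weight (α : Fin 3 → ℕ) : ℝ :=
  (∏ u, ((α u).factorial : ℝ)) / ((∑ u, α u).factorial : ℝ)

/-- The domain `Ω_A = Ω(𝔄)` of the Arveson space. -/
def OmegaA : Set H :=
  {x | x ∈ Hstar ∧ Summable fun α : Fin 3 → ℕ => ‖muPow α x‖ ^ 2 * (weight α)⁻¹}

/-- The set `Ω₁(𝔄)`. -/
def Omega1 : Set H := {x | x ∈ Hstar ∧ ∑ u, ‖mu u x‖ ^ 2 < 1}

/-- `f` belongs to the Arveson space `𝔄`, with (uniquely determined) coefficients `c`: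
`∑ (α!/|α|!) |c_α|² < ∞` and `f(x) = ∑ μ^α(x) c_α`, absolutely convergent on `Ω_A`. -/
structure HasArvesonSeries (f : H → H) (c : (Fin 3 → ℕ) → H) : Prop where
  sq_summable : Summable fun α => weight α * ‖c α‖ ^ 2
  abs_summable : ∀ x ∈ OmegaA, Summable fun α => ‖muPow α x * c α‖
  hasSum : ∀ x ∈ OmegaA, HasSum (fun α => muPow α x * c α) (f x)

/-- The squared norm `⟨f, f⟩ = ∑ (α!/|α|!) |c_α|²` in `𝔄`, in terms of the coefficients. -/
def normSq (c : (Fin 3 → ℕ) → H) : ℝ := ∑' α, weight α * ‖c α‖ ^ 2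

/-- `F` (a column of functions) belongs to `𝔄ᵐ`, with coefficients `c`. -/
def HasArvesonSeriesVec {m : ℕ} (F : H → Matrix (Fin m) (Fin 1) H)
    (c : Fin m → (Fin 3 → ℕ) → H) : Prop :=
  ∀ i, HasArvesonSeries (fun x => F x i 0) (c i)

/-- The squared norm in `𝔄ᵐ`. -/
def normSqVec {m : ℕ} (c : Fin m → (Fin 3 → ℕ) → H) : ℝ := ∑ i, normSq (c i)

/-- `P` is the CK-extension to `Ω_A` of the function `φ` of `(x₁, x₂, x₃)`: it is `V_q`-regular on
`Ω_A` and coincides with `φ` where `x₀ = 0`. -/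
def IsCKExtension {n m : ℕ} (φ P : H → Matrix (Fin n) (Fin m) H) : Prop :=
  MatVqRegularOn P OmegaA ∧ ∀ x ∈ OmegaA, x.re = 0 → P x = φ x

/-- `P = F ⋆ G` on `Ω_A`: the CK-product of the `V_q`-regular functions `F` and `G`, that is, the
CK-extension of the product of their restrictions to `x₀ = 0`. -/
def IsStarProd {n k m : ℕ} (F : H → Matrix (Fin n) (Fin k) H) (G : H → Matrix (Fin k) (Fin m) H)
    (P : H → Matrix (Fin n) (Fin m) H) : Prop :=
  MatVqRegularOn F OmegaA ∧ MatVqRegularOn G OmegaA ∧ IsCKExtension (fun x => F x * G x) P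

/-- `R = F^{-⋆}` on `Ω_A`: the inverse of `F` for the CK-product. -/
def IsStarInverse {n : ℕ} (F R : H → Matrix (Fin n) (Fin n) H) : Prop :=
  IsStarProd F R (fun _ => 1) ∧ IsStarProd R F (fun _ => 1)

/-- Positive definite quaternionic Hermitian matrices. -/
def QPosDef {n : ℕ} (M : Matrix (Fin n) (Fin n) H) : Prop :=
  M.IsHermitian ∧ ∀ v : Fin n → H, v ≠ 0 → 0 < (star v ⬝ᵥ (M *ᵥ v)).re

/-- `S = M^{1/2}` for a positive definite `M`. -/
def IsPosSqrt {n : ℕ} (M S : Matrix (Fin n) (Fin n) H) : Prop :=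
  QPosDef M ∧ QPosDef S ∧ S * S = M

/-- `D = M^{-1/2}` for a positive definite `M`. -/
def IsPosInvSqrt {n : ℕ} (M D : Matrix (Fin n) (Fin n) H) : Prop :=
  QPosDef M ∧ QPosDef D ∧ (D * D) * M = 1 ∧ M * (D * D) = 1

/-- On `Ω_A`, `B(x)` equals
`(1 - μ(a)μ(a)*)^{1/2} (1 - μ(x)μ(a)*)^{-⋆} ⋆ (μ(x) - μ(a)) (I₃ - μ(a)*μ(a))^{-1/2}`. -/
def IsBlaschkeFactor (a : H) (B : H → Matrix (Fin 1) (Fin 3) H) : Prop :=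
  ∃ (S : Matrix (Fin 1) (Fin 1) H) (R : H → Matrix (Fin 1) (Fin 1) H)
    (N : H → Matrix (Fin 1) (Fin 3) H) (D : Matrix (Fin 3) (Fin 3) H),
    IsPosSqrt (1 - muRow a * (muRow a)ᴴ) S ∧
    IsPosInvSqrt (1 - (muRow a)ᴴ * muRow a) D ∧
    IsStarInverse (fun x => 1 - muRow x * (muRow a)ᴴ) R ∧
    IsStarProd R (fun x => muRow x - muRow a) N ∧
    ∀ x ∈ OmegaA, B x = S * N x * D

/-- `f ↦ S ⋆ f` maps `𝔄ᵐ` into `𝔄ⁿ`, with operator norm at most `k`. -/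
def IsMultiplierWithBound {n m : ℕ} (S : H → Matrix (Fin n) (Fin m) H) (k : ℝ) : Prop :=
  ∀ (f : H → Matrix (Fin m) (Fin 1) H) (c : Fin m → (Fin 3 → ℕ) → H),
    HasArvesonSeriesVec f c →
    ∃ (g : H → Matrix (Fin n) (Fin 1) H) (d : Fin n → (Fin 3 → ℕ) → H),
      IsStarProd S f g ∧ HasArvesonSeriesVec g d ∧ normSqVec d ≤ k ^ 2 * normSqVec c

/-- Multiplication by `S` is a strict contraction (operator norm `< 1`) from `𝔄ᵐ` into `𝔄ⁿ`. -/
def IsStrictlyContractiveMultiplier {n m : ℕ} (S : H → Matrix (Fin n) (Fin m) H) : Prop :=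
  ∃ k : ℝ, 0 ≤ k ∧ k < 1 ∧ IsMultiplierWithBound S k

/-- Schur multipliers: contractive multipliers from `𝔄ᵐ` into `𝔄ⁿ`. -/
def IsSchurMultiplier {n m : ℕ} (S : H → Matrix (Fin n) (Fin m) H) : Prop :=
  IsMultiplierWithBound S 1

end

end VqArveson

namespace VqArveson

noncomputable section

open Matrix Finset

/-! ### Weights and sums by total degree -/

/-! On `x₀ = 0` the variables `μᵤ` are the real numbers `xᵤ`, so a `⋆`-product is an ordinary
product there: real monomials commute with quaternionic coefficients, and everything reduces to
coefficient families. Regularity on `Ω_A` comes from `HasArvesonSeries.vqRegularOn`: every series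
with square-summable weighted coefficients is regular, by termwise differentiation.

The norm estimate rests on two facts. The row `(x₁, x₂, x₃)` is a contraction from each degree to
the next (`degNormSq_sum_shift_succ`). And if `g = (1 - ∑ xᵤāᵤ)⁻¹ ∑ (xᵤ - aᵤ)hᵤ`, with `aᵤ = μᵤ(a)`,
then `g + ∑ aᵤhᵤ = ∑ xᵤ(hᵤ + āᵤg)` (`mobiusCoeff_add`). Comparing norms of the two sides and
expanding (`norm_sq_mobius`) gives `(1 - ∑|aᵤ|²)‖g‖² ≤ ∑‖hᵤ‖² - ‖∑ aᵤhᵤ‖²`. For `h = (I -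
μ(a)*μ(a))^{-1/2} f` the right side is `‖f‖²` (`IsPosInvSqrt.sum_norm_sq`), and the left side is the
squared norm of `(1 - μ(a)μ(a)*)^{1/2} g = B ⋆ f`. Finiteness of `‖g‖` is not known beforehand, so
the comparison is carried out on truncations by degree (`sum_degNormSq_mobiusCoeff_le`). -/

lemma weight_pos (α : Fin 3 → ℕ) : 0 < weight α := by
  unfold weight; positivity

lemma inv_weight (α : Fin 3 → ℕ) : (weight α)⁻¹ = (Nat.multinomial univ α : ℝ) := by
  have h : ((∏ u, (α u).factorial : ℕ) : ℝ) * (Nat.multinomial univ α : ℝ)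
      = ((∑ u, α u).factorial : ℕ) := by
    exact_mod_cast Nat.multinomial_spec univ α
  push_cast at h
  have hp : (∏ u, ((α u).factorial : ℝ)) ≠ 0 := by positivity
  rw [weight, inv_div, ← h]
  field_simp

lemma weight_add_single (α : Fin 3 → ℕ) (u : Fin 3) :
    weight (α + Pi.single u 1) * ((∑ v, α v : ℕ) + 1 : ℝ) = weight α * (α u + 1 : ℝ) := by
  have h2 : ∑ v, (α + Pi.single u 1 : Fin 3 → ℕ) v = (∑ v, α v) + 1 := by
    simp [Finset.sum_add_distrib]
  have h1 : ∏ v, (((α + Pi.single u 1 : Fin 3 → ℕ) v).factorial : ℝ)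
      = (∏ v, ((α v).factorial : ℝ)) * (α u + 1) := by
    fin_cases u <;> simp [Fin.prod_univ_three, Nat.factorial_succ] <;> ring
  unfold weight
  rw [h1, h2, Nat.factorial_succ]
  push_cast
  have : ((∑ v, α v).factorial : ℝ) ≠ 0 := by positivity
  have : ((∑ v, (α v : ℝ)) + 1) ≠ 0 := by positivity
  field_simp

/-- The sum of `f` over the multi-indices of total degree `k`. -/
def degSum (f : (Fin 3 → ℕ) → ℝ) (k : ℕ) : ℝ := ∑ α ∈ piAntidiag univ k, f α

lemma degSum_nonneg {f : (Fin 3 → ℕ) → ℝ} (hf : ∀ α, 0 ≤ f α) (k : ℕ) : 0 ≤ degSum f k :=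
  sum_nonneg fun α _ => hf α

lemma mem_piAntidiag_univ {α : Fin 3 → ℕ} {k : ℕ} : α ∈ piAntidiag univ k ↔ ∑ u, α u = k := by
  simp [mem_piAntidiag]

lemma sum_degSum (f : (Fin 3 → ℕ) → ℝ) (n : ℕ) :
    ∑ k ∈ range n, degSum f k = ∑ α ∈ (range n).biUnion (piAntidiag univ), f α := by
  rw [sum_biUnion]
  · rfl
  · intro i _ j _ hij
    rw [Function.onFun, Finset.disjoint_left]
    intro α h1 h2
    rw [mem_piAntidiag_univ] at h1 h2
    exact hij (h1.symm.trans h2)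

/-- Any finite set of multi-indices lies below some total degree, so bounds on degree truncations
control all finite partial sums. -/
lemma summable_of_sum_degSum_le {f : (Fin 3 → ℕ) → ℝ} (hf : ∀ α, 0 ≤ f α) {C : ℝ}
    (h : ∀ n, ∑ k ∈ range n, degSum f k ≤ C) : Summable f ∧ ∑' α, f α ≤ C := by
  have key : ∀ s : Finset (Fin 3 → ℕ), ∑ α ∈ s, f α ≤ C := by
    intro s
    refine le_trans ?_ (h (s.sup (fun α => ∑ u, α u) + 1))
    rw [sum_degSum]
    refine sum_le_sum_of_subset_of_nonneg ?_ fun α _ _ => hf α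
    intro α hα
    rw [mem_biUnion]
    refine ⟨∑ u, α u, ?_, mem_piAntidiag_univ.2 rfl⟩
    rw [mem_range]
    exact Nat.lt_succ_of_le (Finset.le_sup (f := fun α : Fin 3 → ℕ => ∑ u, α u) hα)
  have hs := summable_of_sum_le hf key
  exact ⟨hs, hs.tsum_le_of_sum_le key⟩

lemma sum_degSum_le_tsum {f : (Fin 3 → ℕ) → ℝ} (hf : ∀ α, 0 ≤ f α) (hs : Summable f) (n : ℕ) :
    ∑ k ∈ range n, degSum f k ≤ ∑' α, f α := by
  rw [sum_degSum]
  exact hs.sum_le_tsum _ fun α _ => hf α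

lemma summable_of_summable_degSum {f : (Fin 3 → ℕ) → ℝ} (hf : ∀ α, 0 ≤ f α)
    (h : Summable (degSum f)) : Summable f :=
  (summable_of_sum_degSum_le hf fun _ => h.sum_le_tsum _ fun k _ => degSum_nonneg hf k).1

/-- This is the multinomial theorem, since the inverse weights are multinomial coefficients. -/
lemma degSum_pow_div_weight (t : Fin 3 → ℝ) (k : ℕ) :
    degSum (fun α => (∏ u, t u ^ α u) * (weight α)⁻¹) k = (∑ u, t u) ^ k := by
  rw [degSum, sum_pow_eq_sum_piAntidiag]
  exact sum_congr rfl fun α _ => by rw [inv_weight, mul_comm]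

/-! ### Shifts of coefficient families -/

/-- The coefficients of `xᵤ y`, where `y` is given by its coefficients. -/
def shift (u : Fin 3) (y : (Fin 3 → ℕ) → H) (β : Fin 3 → ℕ) : H :=
  if β u = 0 then 0 else y (β - Pi.single u 1)

lemma sub_single_add_single {β : Fin 3 → ℕ} {u : Fin 3} (h : β u ≠ 0) :
    β - Pi.single u 1 + Pi.single u 1 = β := by
  funext v
  rcases eq_or_ne v u with rfl | hv
  · simp; omega
  · simp [hv]

@[simp] lemma shift_add_single (u : Fin 3) (y : (Fin 3 → ℕ) → H) (α : Fin 3 → ℕ) :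
    shift u y (α + Pi.single u 1) = y α := by
  have h : α + Pi.single u 1 - Pi.single u 1 = α := by funext v; simp
  rw [shift, if_neg (by simp), h]

lemma shift_zero (u : Fin 3) (y : (Fin 3 → ℕ) → H) : shift u y 0 = 0 := by simp [shift]

lemma shift_of_ne (u : Fin 3) (y : (Fin 3 → ℕ) → H) {β : Fin 3 → ℕ} (h : β ∉ Set.range
    fun α : Fin 3 → ℕ => α + Pi.single u 1) : shift u y β = 0 := by
  rw [shift, if_pos]
  by_contra h0
  exact h ⟨_, sub_single_add_single h0⟩

lemma degSum_shift (u : Fin 3) (ψ : (Fin 3 → ℕ) → ℝ) (k : ℕ) :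
    degSum (fun β => if β u = 0 then 0 else ψ (β - Pi.single u 1)) (k + 1) = degSum ψ k := by
  unfold degSum
  symm
  refine sum_of_injOn (fun α => α + Pi.single u 1) ?_ ?_ ?_ ?_
  · intro α _ β _ h
    exact add_right_cancel h
  · intro α hα
    rw [mem_coe, mem_piAntidiag_univ] at hα ⊢
    simp [Finset.sum_add_distrib, hα]
  · intro β hβ hn
    by_cases h0 : β u = 0
    · simp [h0]
    · refine absurd ⟨β - Pi.single u 1, ?_, sub_single_add_single h0⟩ hn
      rw [mem_piAntidiag_univ] at hβ
      rw [mem_coe, mem_piAntidiag_univ]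
      rw [← sub_single_add_single h0] at hβ
      simpa [Finset.sum_add_distrib] using hβ
  · intro α _
    have h : α + Pi.single u 1 - Pi.single u 1 = α := by funext v; simp
    simp only [h]
    rw [if_neg (by simp)]

/-- Cauchy–Schwarz with the probabilities `βᵤ/|β|`. The Arveson weights are exactly those for which
`weight β · |β| = weight (β - eᵤ) · βᵤ`, so no constant is lost. -/
lemma weight_mul_norm_sum_shift_le (y : Fin 3 → (Fin 3 → ℕ) → H) {β : Fin 3 → ℕ} (hβ : β ≠ 0) :
    weight β * ‖∑ u, shift u (y u) β‖ ^ 2 ≤ ∑ u, if β u = 0 then 0 else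
      weight (β - Pi.single u 1) * ‖y u (β - Pi.single u 1)‖ ^ 2 := by
  have hN : 0 < ∑ v, (β v : ℝ) := by
    have h0 : ∃ v, β v ≠ 0 := by
      by_contra! h
      exact hβ (funext h)
    obtain ⟨v, hv⟩ := h0
    exact sum_pos' (fun _ _ => by positivity) ⟨v, mem_univ _, by positivity⟩
  have hw := weight_pos β
  have hr : ∀ u, β u ≠ 0 → weight β * (∑ v, (β v : ℝ)) = weight (β - Pi.single u 1) * β u := by
    intro u hu
    have h := weight_add_single (β - Pi.single u 1) u
    have h1 : (((β - Pi.single u 1 : Fin 3 → ℕ) u : ℕ) : ℝ) + 1 = β u := by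
      have := congrFun (sub_single_add_single hu) u
      rw [← this]; simp
    have h2 : (((∑ v, (β - Pi.single u 1 : Fin 3 → ℕ) v : ℕ) : ℝ) + 1) = ∑ v, (β v : ℝ) := by
      have : (∑ v, (β - Pi.single u 1 : Fin 3 → ℕ) v) + 1 = ∑ v, β v := by
        conv_rhs => rw [← sub_single_add_single hu]
        simp [Finset.sum_add_distrib]
      exact_mod_cast this
    rw [sub_single_add_single hu, h1, h2] at h
    exact h
  have hcs : (∑ u, ‖shift u (y u) β‖) ^ 2 ≤ (∑ u, (β u : ℝ) / (∑ v, (β v : ℝ))) *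
      ∑ u, (if β u = 0 then 0 else
        weight (β - Pi.single u 1) * ‖y u (β - Pi.single u 1)‖ ^ 2) / weight β := by
    refine sum_sq_le_sum_mul_sum_of_sq_le_mul _ (fun u _ => by positivity) (fun u _ => ?_)
      fun u _ => ?_
    · split_ifs
      · simp
      · have := weight_pos (β - Pi.single u 1)
        positivity
    · refine le_of_eq ?_
      by_cases hu : β u = 0
      · simp [shift, hu]
      · rw [shift, if_neg hu, if_neg hu]
        have := hr u hu
        field_simp
        linear_combination ‖y u (β - Pi.single u 1)‖ ^ 2 * this
  rw [← sum_div, ← sum_div, div_self hN.ne', one_mul, le_div_iff₀ hw] at hcs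
  refine le_trans ?_ hcs
  rw [mul_comm]
  gcongr
  exact norm_sum_le _ _

/-- The squared norm of the homogeneous part of degree `k`. -/
def degNormSq (y : (Fin 3 → ℕ) → H) (k : ℕ) : ℝ := degSum (fun α => weight α * ‖y α‖ ^ 2) k

lemma degNormSq_nonneg (y : (Fin 3 → ℕ) → H) (k : ℕ) : 0 ≤ degNormSq y k :=
  degSum_nonneg (fun α => mul_nonneg (weight_pos α).le (sq_nonneg _)) k

lemma degNormSq_sum_shift_zero (y : Fin 3 → (Fin 3 → ℕ) → H) :
    degNormSq (fun β => ∑ u, shift u (y u) β) 0 = 0 := by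
  simp [degNormSq, degSum, shift_zero]

/-- The row `(x₁, x₂, x₃)` is a contraction, degree by degree. -/
lemma degNormSq_sum_shift_succ (y : Fin 3 → (Fin 3 → ℕ) → H) (k : ℕ) :
    degNormSq (fun β => ∑ u, shift u (y u) β) (k + 1) ≤ ∑ u, degNormSq (y u) k := by
  have h : ∀ u, degNormSq (y u) k = degSum (fun β => if β u = 0 then 0 else
      weight (β - Pi.single u 1) * ‖y u (β - Pi.single u 1)‖ ^ 2) (k + 1) := fun u =>
    (degSum_shift u (fun α => weight α * ‖y u α‖ ^ 2) k).symm
  simp only [h]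
  unfold degNormSq degSum
  rw [sum_comm]
  refine sum_le_sum fun β hβ => weight_mul_norm_sum_shift_le y ?_
  rintro rfl
  rw [mem_piAntidiag_univ] at hβ
  simp at hβ

/-- The solution `g` of `g = p + ∑ᵤ xᵤ bᵤ g`. -/
def solve (b : Fin 3 → H) (p : (Fin 3 → ℕ) → H) (β : Fin 3 → ℕ) : H :=
  p β + ∑ u, if h : β u = 0 then 0 else b u * solve b p (β - Pi.single u 1)
termination_by ∑ u, β u
decreasing_by
  have := congrArg (fun γ : Fin 3 → ℕ => ∑ v, γ v) (sub_single_add_single h)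
  simp [Finset.sum_add_distrib] at this
  simp only [Pi.sub_apply]
  omega

lemma solve_eq (b : Fin 3 → H) (p : (Fin 3 → ℕ) → H) (β : Fin 3 → ℕ) :
    solve b p β = p β + ∑ u, shift u (fun α => b u * solve b p α) β := by
  rw [solve]
  simp [shift]

/-! ### The domain `Ω_A` -/

lemma norm_muPow (α : Fin 3 → ℕ) (x : H) : ‖muPow α x‖ = ∏ u, ‖mu u x‖ ^ α u := by
  simp [muPow, Fin.prod_univ_three, norm_mul, norm_pow]

lemma norm_muPow_sq_div_weight (α : Fin 3 → ℕ) (x : H) :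
    ‖muPow α x‖ ^ 2 * (weight α)⁻¹ = (∏ u, (‖mu u x‖ ^ 2) ^ α u) * (weight α)⁻¹ := by
  rw [norm_muPow, ← prod_pow]
  simp only [← pow_mul, mul_comm]

/-- Grouped by degree, the defining series becomes the geometric series with ratio `∑ ‖μᵤ(x)‖²`. -/
lemma mem_OmegaA {x : H} : x ∈ OmegaA ↔ x ∈ Hstar ∧ ∑ u, ‖mu u x‖ ^ 2 < 1 := by
  have h0 : ∀ α : Fin 3 → ℕ, 0 ≤ (∏ u, (‖mu u x‖ ^ 2) ^ α u) * (weight α)⁻¹ := fun α =>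
    mul_nonneg (prod_nonneg fun _ _ => by positivity) (inv_nonneg.2 (weight_pos α).le)
  have hs : 0 ≤ ∑ u, ‖mu u x‖ ^ 2 := by positivity
  have hd : degSum (fun α => (∏ u, (‖mu u x‖ ^ 2) ^ α u) * (weight α)⁻¹)
      = fun k => (∑ u, ‖mu u x‖ ^ 2) ^ k := funext (degSum_pow_div_weight _)
  simp only [OmegaA, Set.mem_ofPred_eq, norm_muPow_sq_div_weight]
  refine and_congr_right fun _ => ⟨fun h => ?_, fun h => ?_⟩
  -- If the ratio were at least 1, each degree would contribute at least 1 and the partial sums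
  -- would be unbounded.
  · by_contra! h1
    obtain ⟨n, hn⟩ := exists_nat_gt (∑' α : Fin 3 → ℕ, (∏ u, (‖mu u x‖ ^ 2) ^ α u) * (weight α)⁻¹)
    have h2 := sum_degSum_le_tsum h0 h n
    rw [hd] at h2
    have h3 : ∑ k ∈ range n, (1 : ℝ) ≤ ∑ k ∈ range n, (∑ u, ‖mu u x‖ ^ 2) ^ k :=
      sum_le_sum fun k _ => one_le_pow₀ h1
    simp at h3
    linarith
  · refine summable_of_summable_degSum h0 ?_
    rw [hd]
    exact summable_geometric_of_lt_one hs h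

/-! ### Calculus in normed division algebras -/

section Calculus

variable {E F A : Type*} [NormedAddCommGroup E] [NormedSpace ℝ E] [NormedAddCommGroup F]
  [NormedSpace ℝ F] [NormedDivisionRing A] [NormedAlgebra ℝ A]

/-- The bounds have logarithmic-derivative form: the constants `K`, `K'` add under products. A
monomial of degree `|α|` thus acquires only the factor `|α|·C`, even where some variable vanishes.
-/
lemma norm_fderiv_mul_le {f g : E → A} {x : E} (hf : DifferentiableAt ℝ f x)
    (hg : DifferentiableAt ℝ g x) {b b' K K' : ℝ} (hb : ‖f x‖ ≤ b) (hb' : ‖g x‖ ≤ b')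
    (hK : ‖fderiv ℝ f x‖ ≤ K * b) (hK' : ‖fderiv ℝ g x‖ ≤ K' * b') :
    ‖fderiv ℝ (fun y => f y * g y) x‖ ≤ (K + K') * (b * b') := by
  have h0 := (norm_nonneg _).trans hb
  have h1 := (norm_nonneg _).trans hK
  have h : fderiv ℝ (fun y => f y * g y) x = _ := fderiv_mul' hf hg
  rw [h]
  calc _ ≤ ‖f x‖ * ‖fderiv ℝ g x‖ + ‖fderiv ℝ f x‖ * ‖g x‖ := by
        refine ContinuousLinearMap.opNorm_le_bound _ (by positivity) fun v => ?_
        have hg' := (fderiv ℝ g x).le_opNorm v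
        have hf' := (fderiv ℝ f x).le_opNorm v
        calc _ ≤ ‖f x‖ * ‖fderiv ℝ g x v‖ + ‖fderiv ℝ f x v‖ * ‖g x‖ :=
              norm_add_le_of_le (norm_mul_le _ _) (norm_mul_le _ _)
          _ ≤ ‖f x‖ * (‖fderiv ℝ g x‖ * ‖v‖) + ‖fderiv ℝ f x‖ * ‖v‖ * ‖g x‖ := by gcongr
          _ = _ := by ring
    _ ≤ b * (K' * b') + K * b * b' := by gcongr
    _ = _ := by ring

lemma norm_fderiv_pow_le {f : E → A} {x : E} (hf : DifferentiableAt ℝ f x) {b C : ℝ}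
    (hb : ‖f x‖ ≤ b) (hC : ‖fderiv ℝ f x‖ ≤ C * b) (n : ℕ) :
    ‖fderiv ℝ (fun y => f y ^ n) x‖ ≤ (n * C) * b ^ n := by
  induction n with
  | zero => simp
  | succ n ih =>
    simp only [pow_succ]
    have h : ‖f x ^ n‖ ≤ b ^ n := by rw [norm_pow]; gcongr
    refine (norm_fderiv_mul_le (hf.pow n) hf h hb ih hC).trans (le_of_eq ?_)
    push_cast; ring

lemma norm_fderiv_monomial_mul_le {m : Fin 3 → E → A} (α : Fin 3 → ℕ) (c : A) {x : E}
    (hd : ∀ u, DifferentiableAt ℝ (m u) x) {b : Fin 3 → ℝ} {C : ℝ} (hb : ∀ u, ‖m u x‖ ≤ b u)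
    (hC : ∀ u, ‖fderiv ℝ (m u) x‖ ≤ C * b u) :
    ‖fderiv ℝ (fun y => m 0 y ^ α 0 * m 1 y ^ α 1 * m 2 y ^ α 2 * c) x‖
      ≤ ((∑ u, α u : ℕ) * C) * (∏ u, b u ^ α u) * ‖c‖ := by
  have hp : ∀ u, ‖m u x ^ α u‖ ≤ b u ^ α u := fun u => by rw [norm_pow]; gcongr; exact hb u
  have hk := fun u => norm_fderiv_pow_le (hd u) (hb u) (hC u) (α u)
  have h2 := norm_fderiv_mul_le ((hd 0).pow (α 0)) ((hd 1).pow (α 1)) (hp 0) (hp 1) (hk 0) (hk 1)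
  have h3 := norm_fderiv_mul_le (((hd 0).pow (α 0)).mul ((hd 1).pow (α 1)))
    ((hd 2).pow (α 2)) (norm_mul_le_of_le (hp 0) (hp 1)) (hp 2) h2 (hk 2)
  have h4 := norm_fderiv_mul_le ((((hd 0).pow (α 0)).mul ((hd 1).pow (α 1))).mul
    ((hd 2).pow (α 2))) (differentiableAt_const c)
    (norm_mul_le_of_le (norm_mul_le_of_le (hp 0) (hp 1)) (hp 2)) le_rfl h3 (K' := 0) (by simp)
  refine h4.trans (le_of_eq ?_)
  simp only [Fin.sum_univ_three, Fin.prod_univ_three]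
  push_cast; ring

lemma continuousAt_norm_fderiv {f : E → F} {x : E} (hf : ContDiffAt ℝ 2 f x) :
    ContinuousAt (fun y => ‖fderiv ℝ f y‖) x :=
  (hf.fderiv_right (m := 1) (by norm_num)).continuousAt.norm

lemma contDiffAt_tsum_of_ball [CompleteSpace F] {ι : Type*} {f : ι → E → F} {u : ι → ℝ} {x : E}
    {ε : ℝ} (hε : 0 < ε) (hu : Summable u)
    (hf : ∀ i, ∀ y ∈ Metric.ball x ε, ContDiffAt ℝ 2 (f i) y)
    (hbd : ∀ i, ∀ y ∈ Metric.ball x ε, ‖fderiv ℝ (f i) y‖ ≤ u i) (h0 : Summable fun i => f i x) :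
    ContDiffAt ℝ 1 (fun y => ∑' i, f i y) x ∧
      ∀ v, HasSum (fun i => fderiv ℝ (f i) x v) (fderiv ℝ (fun y => ∑' i, f i y) x v) := by
  have hxb := Metric.mem_ball_self (x := x) hε
  have hder : ∀ y ∈ Metric.ball x ε, HasFDerivAt (fun x => ∑' i, f i x)
      (∑' i, fderiv ℝ (f i) y) y := fun y hy =>
    hasFDerivAt_tsum_of_isPreconnected hu Metric.isOpen_ball (convex_ball x ε).isPreconnected
      (fun i z hz => ((hf i z hz).differentiableAt two_ne_zero).hasFDerivAt) hbd hxb h0 hy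
  refine ⟨contDiffAt_one_iff.2 ⟨_, Metric.ball x ε, Metric.ball_mem_nhds x hε,
    continuousOn_tsum (fun i y hy => ?_) hu hbd, hder⟩, fun v => ?_⟩
  · exact ((hf i y hy).fderiv_right (m := 1) (by norm_num)).continuousAt.continuousWithinAt
  · have hs : Summable fun i => fderiv ℝ (f i) x :=
      Summable.of_norm_bounded hu fun i => hbd i x hxb
    rw [(hder x hxb).fderiv]
    exact (ContinuousLinearMap.apply ℝ F v).hasSum hs.hasSum

lemma contDiffAt_inv_comp [CompleteSpace A] {f : E → A} {x : E} {n : WithTop ℕ∞}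
    (hf : ContDiffAt ℝ n f x) (hx : f x ≠ 0) : ContDiffAt ℝ n (fun y => (f y)⁻¹) x := by
  have h : ContDiffAt ℝ n Ring.inverse (f x) := contDiffAt_ringInverse ℝ (Units.mk0 (f x) hx)
  rw [Ring.inverse_eq_inv'] at h
  exact h.comp x hf

end Calculus

/-! ### Derivatives of the variables `μᵤ` -/

/-- `coord u` as a continuous linear map. -/
def coordL (u : Fin 3) : H →L[ℝ] ℝ := LinearMap.toContinuousLinearMap
  { toFun := coord u
    map_add' := fun x y => by fin_cases u <;> simp [coord]
    map_smul' := fun r x => by fin_cases u <;> simp [coord] }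

@[simp] lemma coordL_apply (u : Fin 3) (x : H) : coordL u x = coord u x := rfl

/-- The real part as a continuous linear map. -/
def reL : H →L[ℝ] ℝ := LinearMap.toContinuousLinearMap
  { toFun := fun x => x.re
    map_add' := fun x y => by simp
    map_smul' := fun r x => by simp }

@[simp] lemma reL_apply (x : H) : reL x = x.re := rfl

/-- The vector part as a continuous linear map. -/
def imL : H →L[ℝ] H := LinearMap.toContinuousLinearMap
  { toFun := fun x => x.im
    map_add' := fun x y => by simp
    map_smul' := fun r x => by simp }

@[simp] lemma imL_apply (x : H) : imL x = x.im := rfl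

lemma mu_eq (u : Fin 3) : mu u = fun x => coordL u x • (1 + reL x • (imL x)⁻¹) := by
  funext x
  simp [mu, Quaternion.coe_mul_eq_smul]

lemma sum_coord_unit (x : H) : ∑ u, coord u x • unit u = x.im := by
  rw [Fin.sum_univ_three]
  ext
  · change x.imI * 0 + x.imJ * 0 + x.imK * 0 = 0
    ring
  · change x.imI * 1 + x.imJ * 0 + x.imK * 0 = x.imI
    ring
  · change x.imI * 0 + x.imJ * 1 + x.imK * 0 = x.imJ
    ring
  · change x.imI * 0 + x.imJ * 0 + x.imK * 1 = x.imK
    ring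

lemma Vq_eq (f : H → H) (x : H) :
    Vq f x = fderiv ℝ f x 1 - (x.im)⁻¹ * fderiv ℝ f x x.im := by
  have h : fderiv ℝ f x x.im = ∑ u, coord u x • fderiv ℝ f x (unit u) := by
    rw [← sum_coord_unit x, map_sum]
    exact sum_congr rfl fun u _ => map_smul _ _ _
  rw [h, Vq]

lemma isOpen_Hstar : IsOpen Hstar :=
  isOpen_ne_fun Quaternion.continuous_im continuous_const

lemma contDiffAt_mu (u : Fin 3) {x : H} (hx : x ∈ Hstar) : ContDiffAt ℝ 2 (mu u) x := by
  rw [mu_eq]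
  refine (coordL u).contDiff.contDiffAt.smul (contDiffAt_const.add
    (reL.contDiff.contDiffAt.smul ?_))
  exact contDiffAt_inv_comp imL.contDiff.contDiffAt hx

lemma contDiffAt_muPow (α : Fin 3 → ℕ) {x : H} (hx : x ∈ Hstar) : ContDiffAt ℝ 2 (muPow α) x :=
  (((contDiffAt_mu 0 hx).pow _).mul ((contDiffAt_mu 1 hx).pow _)).mul ((contDiffAt_mu 2 hx).pow _)

/-- The derivative along `1` is `xᵤ q⃗⁻¹`. Along `q⃗`, `xᵤ` has degree 1 and `q⃗⁻¹` degree -1, so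
the derivative is `xᵤ(1 + x₀/q⃗) - xᵤx₀/q⃗ = xᵤ`; the two terms of `V_q` cancel. -/
lemma Vq_mu (u : Fin 3) {x : H} (hx : x ∈ Hstar) : Vq (mu u) x = 0 := by
  have hx' : imL x ≠ 0 := hx
  have h := (coordL u).hasFDerivAt (x := x) |>.smul
    ((reL.hasFDerivAt (x := x) |>.smul
      ((hasFDerivAt_inv' (𝕜 := ℝ) hx').comp x (imL.hasFDerivAt (x := x)))).const_add (1 : H))
  have h' := h.congr_of_eventuallyEq (f₁ := mu u)
    (Filter.Eventually.of_forall fun y => congrFun (mu_eq u) y)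
  have hc : coord u (1 : H) = 0 := by fin_cases u <;> rfl
  have h1 : (1 : H).re = 1 := rfl
  have h2 : (1 : H).im = 0 := by ext <;> rfl
  have hc' : coord u x.im = coord u x := by fin_cases u <;> simp [coord]
  have hq : x.im ≠ 0 := hx
  have hi : (x.im).im = x.im := by ext <;> simp
  rw [Vq_eq, h'.fderiv]
  simp [hc, hc', hq, hi, h1, h2]

lemma commute_mu (u : Fin 3) (x : H) : Commute (mu u x) x.im := by
  rw [mu_eq]
  refine Commute.smul_left (Commute.add_left (Commute.one_left _) (Commute.smul_left ?_ _)) _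
  exact (Commute.refl (x.im)).inv_left₀

/-! ### `V_q`-regular functions -/

/-- Leibniz' rule survives because `(q⃗)⁻¹` can be moved past the left factor. This applies to
products of the `μᵤ`, which are real combinations of `1` and `q⃗⁻¹`. -/
lemma Vq_mul {f g : H → H} {x : H} (hf : DifferentiableAt ℝ f x) (hg : DifferentiableAt ℝ g x)
    (hc : Commute (f x) x.im) : Vq (fun y => f y * g y) x = Vq f x * g x + f x * Vq g x := by
  have h : fderiv ℝ (fun y => f y * g y) x = _ := fderiv_mul' hf hg
  have hc' : f x * (x.im)⁻¹ = (x.im)⁻¹ * f x := hc.inv_right₀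
  simp only [Vq_eq, h, _root_.add_apply, _root_.smul_apply,
    smul_eq_mul, MulOpposite.smul_eq_mul_unop, MulOpposite.unop_op]
  rw [mul_sub, ← mul_assoc (f x), hc']
  noncomm_ring

lemma Vq_const (c x : H) : Vq (fun _ => c) x = 0 := by
  simp [Vq_eq]

lemma Vq_pow {f : H → H} {x : H} (hf : DifferentiableAt ℝ f x) (hc : Commute (f x) x.im)
    (h : Vq f x = 0) (n : ℕ) : Vq (fun y => f y ^ n) x = 0 := by
  induction n with
  | zero => simpa using Vq_const 1 x
  | succ n ih =>
    simp only [pow_succ']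
    have : Vq (fun y => f y * f y ^ n) x = Vq f x * f x ^ n + f x * Vq (fun y => f y ^ n) x :=
      Vq_mul hf (hf.pow n) hc
    rw [this, h, ih]
    simp

lemma Vq_muPow_mul (α : Fin 3 → ℕ) (c : H) {x : H} (hx : x ∈ Hstar) :
    Vq (fun y => muPow α y * c) x = 0 := by
  have hd : ∀ u, DifferentiableAt ℝ (fun y => mu u y ^ α u) x := fun u =>
    ((contDiffAt_mu u hx).differentiableAt two_ne_zero).pow _
  have hv : ∀ u, Vq (fun y => mu u y ^ α u) x = 0 := fun u =>
    Vq_pow ((contDiffAt_mu u hx).differentiableAt two_ne_zero) (commute_mu u x) (Vq_mu u hx) _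
  have hc : ∀ u, Commute (mu u x ^ α u) x.im := fun u => (commute_mu u x).pow_left _
  rw [Vq_mul ((contDiffAt_muPow α hx).differentiableAt two_ne_zero) (differentiableAt_const c)
    (((hc 0).mul_left (hc 1)).mul_left (hc 2)), Vq_const]
  have h : Vq (muPow α) x = 0 := by
    unfold muPow
    rw [Vq_mul (f := fun y => mu 0 y ^ α 0 * mu 1 y ^ α 1) ((hd 0).mul (hd 1)) (hd 2)
      ((hc 0).mul_left (hc 1)), Vq_mul (hd 0) (hd 1) (hc 0), hv, hv, hv]
    simp
  simp [h]

lemma isOpen_OmegaA : IsOpen OmegaA := by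
  have h : OmegaA = {x | x ∈ Hstar ∧ ∑ u, ‖mu u x‖ ^ 2 < 1} := Set.ext fun x => mem_OmegaA
  rw [h, isOpen_iff_mem_nhds]
  rintro x ⟨hx, hlt⟩
  have hc : ContinuousAt (fun y => ∑ u, ‖mu u y‖ ^ 2) x :=
    tendsto_finsetSum _ fun u _ => ((contDiffAt_mu u hx).continuousAt.norm).pow 2
  filter_upwards [isOpen_Hstar.mem_nhds hx, hc.eventually_lt_const hlt] with y h1 h2
  exact ⟨h1, h2⟩

lemma VqRegularOn.congr {f g : H → H} (hf : VqRegularOn f OmegaA)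
    (h : ∀ x ∈ OmegaA, g x = f x) : VqRegularOn g OmegaA := by
  refine ⟨hf.1.congr h, fun x hx => ?_⟩
  have he : g =ᶠ[nhds x] f := Filter.eventuallyEq_of_mem (isOpen_OmegaA.mem_nhds hx) h
  rw [Vq_eq, he.fderiv_eq, ← Vq_eq, hf.2 x hx]

lemma VqRegularOn.differentiableAt {f : H → H} (hf : VqRegularOn f OmegaA) {x : H}
    (hx : x ∈ OmegaA) : DifferentiableAt ℝ f x :=
  (hf.1.contDiffAt (isOpen_OmegaA.mem_nhds hx)).differentiableAt one_ne_zero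

lemma vqRegularOn_const (c : H) : VqRegularOn (fun _ => c) OmegaA :=
  ⟨contDiffOn_const, fun _ _ => Vq_const c _⟩

lemma vqRegularOn_mu (u : Fin 3) : VqRegularOn (mu u) OmegaA :=
  ⟨fun _ hx => ((contDiffAt_mu u hx.1).of_le one_le_two).contDiffWithinAt,
    fun _ hx => Vq_mu u hx.1⟩

lemma VqRegularOn.add {f g : H → H} (hf : VqRegularOn f OmegaA) (hg : VqRegularOn g OmegaA) :
    VqRegularOn (fun x => f x + g x) OmegaA := by
  refine ⟨hf.1.add hg.1, fun x hx => ?_⟩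
  have h1 := hf.2 x hx
  have h2 := hg.2 x hx
  rw [Vq_eq] at h1 h2 ⊢
  rw [fderiv_fun_add (hf.differentiableAt hx) (hg.differentiableAt hx)]
  simp only [_root_.add_apply, mul_add]
  rw [add_sub_add_comm, h1, h2, add_zero]

lemma VqRegularOn.mul_const {f : H → H} (hf : VqRegularOn f OmegaA) (c : H) :
    VqRegularOn (fun x => f x * c) OmegaA := by
  refine ⟨hf.1.mul contDiffOn_const, fun x hx => ?_⟩
  have h1 := hf.2 x hx
  rw [Vq_eq] at h1 ⊢
  rw [fderiv_mul_const' (hf.differentiableAt hx)]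
  simp only [_root_.smul_apply, MulOpposite.smul_eq_mul_unop, MulOpposite.unop_op]
  rw [← mul_assoc, ← sub_mul, h1, zero_mul]

lemma VqRegularOn.neg {f : H → H} (hf : VqRegularOn f OmegaA) :
    VqRegularOn (fun x => -f x) OmegaA := by
  simpa using hf.mul_const (-1)

lemma VqRegularOn.sub {f g : H → H} (hf : VqRegularOn f OmegaA) (hg : VqRegularOn g OmegaA) :
    VqRegularOn (fun x => f x - g x) OmegaA := by
  simpa [sub_eq_add_neg] using hf.add hg.neg

lemma vqRegularOn_sum {ι : Type*} (s : Finset ι) {f : ι → H → H}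
    (hf : ∀ i ∈ s, VqRegularOn (f i) OmegaA) : VqRegularOn (fun x => ∑ i ∈ s, f i x) OmegaA := by
  classical
  induction s using Finset.induction_on with
  | empty => simpa using vqRegularOn_const 0
  | insert i s hi ih =>
    simp only [sum_insert hi]
    exact (hf i (mem_insert_self i s)).add (ih fun j hj => hf j (mem_insert_of_mem hj))

/-! ### Arveson series are `V_q`-regular -/

lemma mul_le_of_weight (α : Fin 3 → ℕ) (p q : ℝ) :
    p * q ≤ p ^ 2 * (weight α)⁻¹ + weight α * q ^ 2 := by
  have hw := weight_pos α
  have h : p ^ 2 * (weight α)⁻¹ + weight α * q ^ 2 - p * q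
      = (p / 2 - weight α * q) ^ 2 * (weight α)⁻¹ + 3 / 4 * p ^ 2 * (weight α)⁻¹ := by
    field_simp; ring
  have : 0 ≤ (p / 2 - weight α * q) ^ 2 * (weight α)⁻¹ + 3 / 4 * p ^ 2 * (weight α)⁻¹ := by
    positivity
  linarith

/-- Dominates the derivatives of an Arveson series. Square-summability of the coefficients is paired
with `∑ k² s^k < ∞`, where `s = ∑ bᵤ² < 1` arises by grouping in degrees. -/
lemma summable_degree_mul {b : Fin 3 → ℝ} (hb : ∀ u, 0 ≤ b u) (hb1 : ∑ u, b u ^ 2 < 1) {C : ℝ}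
    (hC : 0 ≤ C) {c : (Fin 3 → ℕ) → H} (hc : Summable fun α => weight α * ‖c α‖ ^ 2) :
    Summable fun α : Fin 3 → ℕ => ((∑ u, α u : ℕ) * C) * (∏ u, b u ^ α u) * ‖c α‖ := by
  have h1 : Summable fun α : Fin 3 → ℕ =>
      (((∑ u, α u : ℕ) * C) * (∏ u, b u ^ α u)) ^ 2 * (weight α)⁻¹ := by
    refine summable_of_summable_degSum
      (fun α => mul_nonneg (sq_nonneg _) (inv_nonneg.2 (weight_pos α).le)) ?_
    have hd : degSum (fun α : Fin 3 → ℕ =>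
        (((∑ u, α u : ℕ) * C) * (∏ u, b u ^ α u)) ^ 2 * (weight α)⁻¹)
        = fun k : ℕ => C ^ 2 * ((k : ℝ) ^ 2 * (∑ u, b u ^ 2) ^ k) := by
      funext k
      rw [← degSum_pow_div_weight, degSum, degSum, mul_sum, mul_sum]
      refine sum_congr rfl fun α hα => ?_
      rw [mem_piAntidiag_univ.1 hα, mul_pow, ← prod_pow]
      simp only [← pow_mul, mul_comm _ 2]
      ring
    rw [hd]
    have hr : ‖∑ u, b u ^ 2‖ < 1 := by
      rwa [Real.norm_of_nonneg (sum_nonneg fun u _ => sq_nonneg (b u))]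
    exact (summable_pow_mul_geometric_of_norm_lt_one 2 hr).mul_left (C ^ 2)
  refine Summable.of_nonneg_of_le (fun α => ?_) (fun α => mul_le_of_weight α _ _) (h1.add hc)
  have : 0 ≤ ∏ u, b u ^ α u := prod_nonneg fun u _ => pow_nonneg (hb u) _
  positivity

lemma summable_norm_muPow_mul {c : (Fin 3 → ℕ) → H}
    (hc : Summable fun α => weight α * ‖c α‖ ^ 2) {x : H} (hx : x ∈ OmegaA) :
    Summable fun α => ‖muPow α x * c α‖ := by
  refine Summable.of_nonneg_of_le (fun α => norm_nonneg _) (fun α => ?_) (hx.2.add hc)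
  rw [norm_mul]
  exact mul_le_of_weight α _ _

lemma hasArvesonSeries_tsum {c : (Fin 3 → ℕ) → H}
    (hc : Summable fun α => weight α * ‖c α‖ ^ 2) :
    HasArvesonSeries (fun x => ∑' α, muPow α x * c α) c :=
  ⟨hc, fun _ hx => summable_norm_muPow_mul hc hx,
    fun _ hx => (summable_norm_muPow_mul hc hx).of_norm.hasSum⟩

lemma exists_ball_bounds {x : H} (hx : x ∈ OmegaA) : ∃ (b : Fin 3 → ℝ) (C ε : ℝ),
    (∀ u, 0 ≤ b u) ∧ ∑ u, b u ^ 2 < 1 ∧ 0 ≤ C ∧ 0 < ε ∧ ∀ y ∈ Metric.ball x ε,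
      y ∈ OmegaA ∧ ∀ u, ‖mu u y‖ ≤ b u ∧ ‖fderiv ℝ (mu u) y‖ ≤ C * b u := by
  have hlt := (mem_OmegaA.1 hx).2
  -- Each `‖μᵤ(x)‖` is enlarged by a small `t > 0`, keeping the sum of squares below 1. The bounds
  -- become strictly positive, so a multiple of them dominates the derivatives even where `μᵤ(x) =
  -- 0`.
  have hcont : ContinuousAt (fun t : ℝ => ∑ u, (‖mu u x‖ + t) ^ 2) 0 := by fun_prop
  have hev : ∀ᶠ t in nhds (0 : ℝ), ∑ u, (‖mu u x‖ + t) ^ 2 < 1 :=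
    hcont.eventually_lt_const (by simpa using hlt)
  obtain ⟨t, ht1, ht0⟩ :=
    ((hev.filter_mono nhdsWithin_le_nhds).and (self_mem_nhdsWithin (s := Set.Ioi (0 : ℝ)))).exists
  have ht0 : 0 < t := ht0
  have hb : ∀ u, 0 < ‖mu u x‖ + t := fun u => by positivity
  set C := ∑ u, (‖fderiv ℝ (mu u) x‖ + 1) / (‖mu u x‖ + t)
  have hC : 0 ≤ C := sum_nonneg fun u _ => div_nonneg (by positivity) (hb u).le
  have hfd : ∀ u, ‖fderiv ℝ (mu u) x‖ < C * (‖mu u x‖ + t) := by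
    intro u
    have h1 : (‖fderiv ℝ (mu u) x‖ + 1) / (‖mu u x‖ + t) ≤ C :=
      single_le_sum (f := fun u => (‖fderiv ℝ (mu u) x‖ + 1) / (‖mu u x‖ + t))
        (fun v _ => div_nonneg (by positivity) (hb v).le) (mem_univ u)
    rw [div_le_iff₀ (hb u)] at h1
    linarith
  have hmu : ∀ u, ∀ᶠ y in nhds x, ‖mu u y‖ < ‖mu u x‖ + t := fun u =>
    (contDiffAt_mu u hx.1).continuousAt.norm.eventually_lt_const (by linarith)
  have hdmu : ∀ u, ∀ᶠ y in nhds x, ‖fderiv ℝ (mu u) y‖ < C * (‖mu u x‖ + t) := fun u =>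
    (continuousAt_norm_fderiv (contDiffAt_mu u hx.1)).eventually_lt_const (hfd u)
  have hmem : ∀ᶠ y in nhds x, y ∈ OmegaA := isOpen_OmegaA.mem_nhds hx
  obtain ⟨ε, hε, hball⟩ := Metric.eventually_nhds_iff_ball.1 (hmem.and ((Filter.eventually_all.2 hmu).and
      (Filter.eventually_all.2 hdmu)))
  exact ⟨fun u => ‖mu u x‖ + t, C, ε, fun u => (hb u).le, ht1, hC, hε, fun y hy =>
    ⟨(hball y hy).1, fun u => ⟨((hball y hy).2.1 u).le, ((hball y hy).2.2 u).le⟩⟩⟩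

/-- Arveson series are `V_q`-regular. -/
lemma HasArvesonSeries.vqRegularOn {f : H → H} {c : (Fin 3 → ℕ) → H}
    (h : HasArvesonSeries f c) : VqRegularOn f OmegaA := by
  suffices hF : VqRegularOn (fun x => ∑' α, muPow α x * c α) OmegaA from
    hF.congr fun x hx => (h.hasSum x hx).tsum_eq.symm
  have key : ∀ x ∈ OmegaA, ContDiffAt ℝ 1 (fun x => ∑' α, muPow α x * c α) x ∧
      Vq (fun x => ∑' α, muPow α x * c α) x = 0 := by
    intro x hx
    obtain ⟨b, C, ε, hb0, hb1, hC, hε, hball⟩ := exists_ball_bounds hx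
    have hsum := summable_degree_mul hb0 hb1 hC h.sq_summable
    have hcd : ∀ α, ∀ y ∈ Metric.ball x ε, ContDiffAt ℝ 2 (fun z => muPow α z * c α) y :=
      fun α y hy => (contDiffAt_muPow α (hball y hy).1.1).mul contDiffAt_const
    have hbd : ∀ α, ∀ y ∈ Metric.ball x ε, ‖fderiv ℝ (fun z => muPow α z * c α) y‖
        ≤ ((∑ u, α u : ℕ) * C) * (∏ u, b u ^ α u) * ‖c α‖ := fun α y hy =>
      norm_fderiv_monomial_mul_le α (c α)
        (fun u => (contDiffAt_mu u (hball y hy).1.1).differentiableAt two_ne_zero)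
        (fun u => ((hball y hy).2 u).1) fun u => ((hball y hy).2 u).2
    obtain ⟨h1, h2⟩ := contDiffAt_tsum_of_ball hε hsum hcd hbd
      (summable_norm_muPow_mul h.sq_summable hx).of_norm
    refine ⟨h1, ?_⟩
    rw [Vq_eq]
    refine ((h2 1).sub ((h2 x.im).mul_left (x.im)⁻¹)).unique ?_
    have hz : (fun α => fderiv ℝ (fun z => muPow α z * c α) x 1
        - (x.im)⁻¹ * fderiv ℝ (fun z => muPow α z * c α) x x.im) = fun _ => 0 := by
      funext α
      rw [← Vq_eq]
      exact Vq_muPow_mul α (c α) hx.1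
    rw [hz]
    exact hasSum_zero
  exact ⟨fun x hx => (key x hx).1.contDiffWithinAt, fun x hx => (key x hx).2⟩

/-! ### Power series on `x₀ = 0` -/

lemma mu_of_re_eq_zero {x : H} (hx : x.re = 0) (u : Fin 3) : mu u x = (coord u x : H) := by
  simp [mu, hx]

lemma muPow_of_re_eq_zero {x : H} (hx : x.re = 0) (α : Fin 3 → ℕ) :
    muPow α x = ((∏ u, coord u x ^ α u : ℝ) : H) := by
  simp [muPow, mu_of_re_eq_zero hx, Fin.prod_univ_three]

lemma muPow_mul_left_comm {x : H} (hx : x.re = 0) (α : Fin 3 → ℕ) (q y : H) :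
    muPow α x * (q * y) = q * (muPow α x * y) := by
  rw [muPow_of_re_eq_zero hx, ← mul_assoc, Quaternion.coe_commutes, mul_assoc]

lemma muPow_add_single {x : H} (hx : x.re = 0) (α : Fin 3 → ℕ) (u : Fin 3) :
    muPow (α + Pi.single u 1) x = mu u x * muPow α x := by
  rw [muPow_of_re_eq_zero hx, muPow_of_re_eq_zero hx, mu_of_re_eq_zero hx, ← Quaternion.coe_mul]
  congr 1
  fin_cases u <;> simp [Fin.prod_univ_three, pow_succ] <;> ring

lemma muPow_zero (x : H) : muPow 0 x = 1 := by simp [muPow]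

lemma hasSum_const_mul {x : H} (hx : x.re = 0) (q : H) {y : (Fin 3 → ℕ) → H} {s : H}
    (h : HasSum (fun α => muPow α x * y α) s) :
    HasSum (fun α => muPow α x * (q * y α)) (q * s) := by
  simp only [muPow_mul_left_comm hx]
  exact h.mul_left q

lemma hasSum_shift {x : H} (hx : x.re = 0) (u : Fin 3) {y : (Fin 3 → ℕ) → H} {s : H}
    (h : HasSum (fun α => muPow α x * y α) s) :
    HasSum (fun β => muPow β x * shift u y β) (mu u x * s) := by
  have hinj : Function.Injective fun α : Fin 3 → ℕ => α + Pi.single u 1 := add_left_injective _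
  rw [← hinj.hasSum_iff fun β hβ => by rw [shift_of_ne u y hβ, mul_zero]]
  have he : (fun β => muPow β x * shift u y β) ∘ (fun α : Fin 3 → ℕ => α + Pi.single u 1)
      = fun α => mu u x * (muPow α x * y α) := by
    funext α
    simp only [Function.comp_apply, shift_add_single, muPow_add_single hx, mul_assoc]
  rw [he]
  exact h.mul_left _

lemma hasSum_finset_sum {x : H} {y : Fin 3 → (Fin 3 → ℕ) → H} {s : Fin 3 → H}
    (h : ∀ u, HasSum (fun α => muPow α x * y u α) (s u)) :
    HasSum (fun α => muPow α x * ∑ u, y u α) (∑ u, s u) := by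
  simp only [mul_sum]
  exact hasSum_sum fun u _ => h u

lemma solve_functional_equation {x : H} (hx : x.re = 0) {b : Fin 3 → H} {p : (Fin 3 → ℕ) → H}
    {P G : H} (hp : HasSum (fun α => muPow α x * p α) P)
    (hg : HasSum (fun α => muPow α x * solve b p α) G) :
    G = P + ∑ u, mu u x * (b u * G) := by
  have h1 := hp.add (hasSum_finset_sum fun u => hasSum_shift hx u (hasSum_const_mul hx (b u) hg))
  refine hg.unique ?_
  convert! h1 using 2 with α
  rw [← mul_add, ← solve_eq]

/-! ### Estimates -/

lemma norm_sum_mul_sq_le (a h : Fin 3 → H) :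
    ‖∑ u, a u * h u‖ ^ 2 ≤ (∑ u, ‖a u‖ ^ 2) * ∑ u, ‖h u‖ ^ 2 := by
  calc ‖∑ u, a u * h u‖ ^ 2 ≤ (∑ u, ‖a u‖ * ‖h u‖) ^ 2 := by
        gcongr
        exact norm_sum_le_of_le _ fun u _ => norm_mul_le _ _
    _ ≤ _ := sum_mul_sq_le_sq_mul_sq _ _ _

lemma inner_mul_left_eq (a g h : H) : inner ℝ g (a * h) = inner ℝ h (star a * g) := by
  simp only [Quaternion.inner_def]
  simp
  ring

/-- Both squares contain the cross term `2 Re⟨g, ∑ aᵤhᵤ⟩`, which cancels. -/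
lemma norm_sq_mobius (a h : Fin 3 → H) (g : H) :
    ‖g + ∑ u, a u * h u‖ ^ 2 - ∑ u, ‖h u + star (a u) * g‖ ^ 2
      = (1 - ∑ u, ‖a u‖ ^ 2) * ‖g‖ ^ 2 - (∑ u, ‖h u‖ ^ 2 - ‖∑ u, a u * h u‖ ^ 2) := by
  have h1 : ∀ u, ‖h u + star (a u) * g‖ ^ 2
      = ‖h u‖ ^ 2 + 2 * inner ℝ g (a u * h u) + ‖a u‖ ^ 2 * ‖g‖ ^ 2 := fun u => by
    rw [norm_add_sq_real, inner_mul_left_eq, star_star, norm_mul, norm_star, mul_pow]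
  rw [norm_add_sq_real, inner_sum]
  simp only [h1, sum_add_distrib, ← mul_sum, ← sum_mul]
  ring

lemma degNormSq_const_mul (q : H) (y : (Fin 3 → ℕ) → H) (k : ℕ) :
    degNormSq (fun α => q * y α) k = ‖q‖ ^ 2 * degNormSq y k := by
  rw [degNormSq, degNormSq, degSum, degSum, mul_sum]
  exact sum_congr rfl fun α _ => by rw [norm_mul]; ring

/-- The coefficients of `(1 - ∑ xᵤ āᵤ)⁻¹ ∑ (xᵤ - aᵤ) hᵤ`. -/
def mobiusCoeff (a : Fin 3 → H) (h : Fin 3 → (Fin 3 → ℕ) → H) : (Fin 3 → ℕ) → H :=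
  solve (fun u => star (a u)) fun β => ∑ u, shift u (h u) β - ∑ u, a u * h u β

/-- The defining equation of `g` rearranged so that the row of shifts stands alone on the right,
ready for its contractivity. -/
lemma mobiusCoeff_add (a : Fin 3 → H) (h : Fin 3 → (Fin 3 → ℕ) → H) (β : Fin 3 → ℕ) :
    mobiusCoeff a h β + ∑ u, a u * h u β
      = ∑ u, shift u (fun α => h u α + star (a u) * mobiusCoeff a h α) β := by
  have hs : ∀ u, shift u (fun α => h u α + star (a u) * mobiusCoeff a h α) β
      = shift u (h u) β + shift u (fun α => star (a u) * mobiusCoeff a h α) β := fun u => by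
    unfold shift
    split_ifs <;> simp
  rw [sum_congr rfl fun u _ => hs u, sum_add_distrib]
  conv_lhs => rw [mobiusCoeff, solve_eq]
  simp only [mobiusCoeff]
  abel

/-- The degree-wise identity `key` telescopes: contractivity bounds the shift term in degree `k + 1`
by the `y` term in degree `k`, and the shift term vanishes in degree 0. Only the nonnegative `y`
term in the top degree `n` remains. -/
lemma sum_degNormSq_mobiusCoeff_le (a : Fin 3 → H) (h : Fin 3 → (Fin 3 → ℕ) → H) (n : ℕ) :
    (1 - ∑ u, ‖a u‖ ^ 2) * ∑ k ∈ range (n + 1), degNormSq (mobiusCoeff a h) k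
      + ∑ u, degNormSq (fun α => h u α + star (a u) * mobiusCoeff a h α) n
      ≤ ∑ k ∈ range (n + 1),
        degSum (fun α => weight α * (∑ u, ‖h u α‖ ^ 2 - ‖∑ u, a u * h u α‖ ^ 2)) k := by
  set y : Fin 3 → (Fin 3 → ℕ) → H := fun u α => h u α + star (a u) * mobiusCoeff a h α
  have key : ∀ k, (1 - ∑ u, ‖a u‖ ^ 2) * degNormSq (mobiusCoeff a h) k + ∑ u, degNormSq (y u) k
      = degSum (fun α => weight α * (∑ u, ‖h u α‖ ^ 2 - ‖∑ u, a u * h u α‖ ^ 2)) k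
        + degNormSq (fun β => ∑ u, shift u (y u) β) k := by
    intro k
    simp only [degNormSq, degSum]
    rw [sum_comm, mul_sum, ← sum_add_distrib, ← sum_add_distrib]
    refine sum_congr rfl fun α _ => ?_
    rw [← mobiusCoeff_add, ← mul_sum]
    linear_combination -weight α * norm_sq_mobius a (fun u => h u α) (mobiusCoeff a h α)
  induction n with
  | zero =>
    have := key 0
    rw [degNormSq_sum_shift_zero] at this
    simp only [zero_add, range_one, sum_singleton]
    linarith
  | succ n ih =>
    have h1 := key (n + 1)
    have h2 := degNormSq_sum_shift_succ y n
    rw [sum_range_succ, sum_range_succ (fun k => degSum _ k)]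
    linarith

lemma mobiusCoeff_bound {a : Fin 3 → H} (ha : ∑ u, ‖a u‖ ^ 2 < 1)
    {h : Fin 3 → (Fin 3 → ℕ) → H} {φ : (Fin 3 → ℕ) → ℝ}
    (hφ : ∀ α, ∑ u, ‖h u α‖ ^ 2 - ‖∑ u, a u * h u α‖ ^ 2 = φ α) (h0 : ∀ α, 0 ≤ φ α)
    (hs : Summable fun α => weight α * φ α) :
    (Summable fun α => weight α * ‖mobiusCoeff a h α‖ ^ 2) ∧
      (1 - ∑ u, ‖a u‖ ^ 2) * normSq (mobiusCoeff a h) ≤ ∑' α, weight α * φ α := by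
  have h1 : 0 < 1 - ∑ u, ‖a u‖ ^ 2 := by linarith
  have hle : ∀ n, ∑ k ∈ range n, degNormSq (mobiusCoeff a h) k
      ≤ (∑' α, weight α * φ α) / (1 - ∑ u, ‖a u‖ ^ 2) := by
    intro n
    refine (sum_le_sum_of_subset_of_nonneg (range_mono n.le_succ)
      fun k _ _ => degNormSq_nonneg _ k).trans ?_
    rw [le_div_iff₀ h1, mul_comm]
    have h2 := sum_degNormSq_mobiusCoeff_le a h n
    simp only [hφ] at h2
    have h3 : 0 ≤ ∑ u, degNormSq (fun α => h u α + star (a u) * mobiusCoeff a h α) n :=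
      sum_nonneg fun u _ => degNormSq_nonneg _ n
    have h4 := sum_degSum_le_tsum (fun α => mul_nonneg (weight_pos α).le (h0 α)) hs (n + 1)
    linarith
  obtain ⟨h5, h6⟩ := summable_of_sum_degSum_le
    (fun α => mul_nonneg (weight_pos α).le (sq_nonneg ‖mobiusCoeff a h α‖)) hle
  rw [le_div_iff₀ h1, mul_comm] at h6
  exact ⟨h5, h6⟩

/-- The coefficients of `(1 - ∑ xᵤ āᵤ)⁻¹`. -/
def invCoeff (a : Fin 3 → H) : (Fin 3 → ℕ) → H := solve (fun u => star (a u)) (Pi.single 0 1)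

/-- In positive degree the coefficients satisfy `g = ∑ xᵤāᵤg`, so each degree costs at most a factor
`∑|aᵤ|²`. -/
lemma degNormSq_invCoeff_le (a : Fin 3 → H) (k : ℕ) :
    degNormSq (invCoeff a) k ≤ (∑ u, ‖a u‖ ^ 2) ^ k := by
  induction k with
  | zero =>
    have h : invCoeff a 0 = 1 := by
      rw [invCoeff, solve_eq]
      simp [shift_zero]
    simp [degNormSq, degSum, h, weight]
  | succ k ih =>
    have h : degNormSq (invCoeff a) (k + 1)
        = degNormSq (fun β => ∑ u, shift u (fun α => star (a u) * invCoeff a α) β) (k + 1) := by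
      refine sum_congr rfl fun β hβ => ?_
      have hne : β ≠ 0 := by
        rintro rfl
        rw [mem_piAntidiag_univ] at hβ
        simp at hβ
      have hβ' : invCoeff a β = ∑ u, shift u (fun α => star (a u) * invCoeff a α) β := by
        conv_lhs => rw [invCoeff, solve_eq, Pi.single_eq_of_ne hne, zero_add]
        rfl
      exact congrArg (fun q => weight β * ‖q‖ ^ 2) hβ'
    rw [h, pow_succ']
    refine (degNormSq_sum_shift_succ _ k).trans ?_
    simp only [degNormSq_const_mul, norm_star, ← sum_mul]
    gcongr

lemma summable_invCoeff {a : Fin 3 → H} (ha : ∑ u, ‖a u‖ ^ 2 < 1) :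
    Summable fun α => weight α * ‖invCoeff a α‖ ^ 2 :=
  summable_of_summable_degSum (fun α => mul_nonneg (weight_pos α).le (sq_nonneg _))
    (Summable.of_nonneg_of_le (degNormSq_nonneg _) (degNormSq_invCoeff_le a)
      (summable_geometric_of_lt_one (by positivity) ha))

lemma hasSum_single (x q : H) :
    HasSum (fun α => muPow α x * Pi.single (M := fun _ => H) 0 q α) q := by
  have h := hasSum_ite_eq (0 : Fin 3 → ℕ) q
  convert! h using 2 with α
  by_cases hα : α = 0
  · subst hα; simp [muPow_zero]
  · simp [hα]

lemma invCoeff_functional_equation (a : Fin 3 → H) {x : H} (hx : x.re = 0) {G : H}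
    (hG : HasSum (fun α => muPow α x * invCoeff a α) G) :
    (1 - ∑ u, mu u x * star (a u)) * G = 1 := by
  have h := solve_functional_equation hx (hasSum_single x 1) hG
  rw [sub_mul, one_mul, sum_mul]
  simp only [mul_assoc]
  exact sub_eq_of_eq_add h

lemma mobiusCoeff_functional_equation (a : Fin 3 → H) {h : Fin 3 → (Fin 3 → ℕ) → H} {x : H}
    (hx : x.re = 0) {G : H} {s : Fin 3 → H}
    (hG : HasSum (fun α => muPow α x * mobiusCoeff a h α) G)
    (hs : ∀ u, HasSum (fun α => muPow α x * h u α) (s u)) :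
    (1 - ∑ u, mu u x * star (a u)) * G = ∑ u, (mu u x - a u) * s u := by
  have hp := (hasSum_finset_sum fun u => hasSum_shift hx u (hs u)).sub
    (hasSum_finset_sum fun u => hasSum_const_mul hx (a u) (hs u))
  simp only [← mul_sub] at hp
  have h := solve_functional_equation hx hp hG
  rw [sub_mul, one_mul, sum_mul]
  simp only [mul_assoc, sub_mul, sum_sub_distrib]
  exact sub_eq_of_eq_add h

/-! ### Positive definite matrices -/

lemma star_mul_self_re (q : H) : (star q * q).re = ‖q‖ ^ 2 := by
  rw [Quaternion.star_mul_self, Quaternion.normSq_eq_norm_mul_self, sq]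
  rfl

lemma re_sum {ι : Type*} (s : Finset ι) (f : ι → H) : (∑ i ∈ s, f i).re = ∑ i ∈ s, (f i).re :=
  map_sum reL f s

lemma star_dotProduct_self_re {n : ℕ} (v : Fin n → H) : (star v ⬝ᵥ v).re = ∑ i, ‖v i‖ ^ 2 := by
  simp only [dotProduct, re_sum, Pi.star_apply, star_mul_self_re]

lemma star_dotProduct_gram_re {n : ℕ} (r : Matrix (Fin 1) (Fin n) H) (v : Fin n → H) :
    (star v ⬝ᵥ ((rᴴ * r) *ᵥ v)).re = ‖∑ i, r 0 i * v i‖ ^ 2 := by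
  rw [← mulVec_mulVec, dotProduct_mulVec, ← star_mulVec, star_dotProduct_self_re]
  simp [mulVec, dotProduct]

lemma real_smul_re (t : ℝ) (q : H) : (t • q).re = t * q.re := map_smul reL t q

lemma star_dotProduct_one_add_gram_re {n : ℕ} (r : Matrix (Fin 1) (Fin n) H) (t : ℝ)
    (v : Fin n → H) : (star v ⬝ᵥ ((1 + t • (rᴴ * r)) *ᵥ v)).re
      = ∑ i, ‖v i‖ ^ 2 + t * ‖∑ i, r 0 i * v i‖ ^ 2 := by
  rw [add_mulVec, one_mulVec, dotProduct_add, smul_mulVec, dotProduct_smul,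
    ← star_dotProduct_gram_re, ← star_dotProduct_self_re, ← real_smul_re]
  rfl

lemma sum_norm_sq_pos {n : ℕ} {v : Fin n → H} (hv : v ≠ 0) : 0 < ∑ i, ‖v i‖ ^ 2 := by
  obtain ⟨i, hi⟩ := Function.ne_iff.1 hv
  have hi' : 0 < ‖v i‖ := norm_pos_iff.2 hi
  exact sum_pos' (fun _ _ => by positivity) ⟨i, mem_univ i, by positivity⟩

lemma conjTranspose_real_smul {n m : ℕ} (t : ℝ) (M : Matrix (Fin n) (Fin m) H) :
    (t • M)ᴴ = t • Mᴴ := by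
  ext1 i j
  exact Quaternion.star_smul t (M j i)

lemma qPosDef_one_add_gram {r : Matrix (Fin 1) (Fin 3) H} (hr : ∑ u, ‖r 0 u‖ ^ 2 < 1) {t : ℝ}
    (ht : -1 ≤ t) : QPosDef (1 + t • (rᴴ * r)) := by
  refine ⟨?_, fun v hv => ?_⟩
  · refine isHermitian_one.add ?_
    rw [Matrix.IsHermitian, conjTranspose_real_smul, conjTranspose_mul,
      conjTranspose_conjTranspose]
  · rw [star_dotProduct_one_add_gram_re]
    have h1 := norm_sum_mul_sq_le (fun u => r 0 u) v
    have h2 := sum_norm_sq_pos hv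
    nlinarith [sq_nonneg ‖∑ u, r 0 u * v u‖]

lemma qPosDef_smul_one {t : ℝ} (ht : 0 < t) : QPosDef (t • (1 : Matrix (Fin 1) (Fin 1) H)) := by
  refine ⟨?_, fun v hv => ?_⟩
  · rw [Matrix.IsHermitian, conjTranspose_real_smul, conjTranspose_one]
  · rw [smul_mulVec, one_mulVec, dotProduct_smul, real_smul_re, star_dotProduct_self_re]
    exact mul_pos ht (sum_norm_sq_pos hv)

lemma mul_apply_fin_one {n m : ℕ} (M : Matrix (Fin n) (Fin 1) H) (N : Matrix (Fin 1) (Fin m) H)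
    (i : Fin n) (j : Fin m) : (M * N) i j = M i 0 * N 0 j := by
  simp [Matrix.mul_apply]

lemma row_mul_conjTranspose (r : Matrix (Fin 1) (Fin 3) H) :
    r * rᴴ = (∑ u, ‖r 0 u‖ ^ 2) • (1 : Matrix (Fin 1) (Fin 1) H) := by
  have h : ∀ q : H, q * star q = ‖q‖ ^ 2 • (1 : H) := fun q => by
    rw [Quaternion.self_mul_star, Quaternion.normSq_eq_norm_mul_self, ← sq,
      ← Quaternion.coe_mul_eq_smul, mul_one]
  ext1 i j
  fin_cases i
  fin_cases j
  simp [Matrix.mul_apply, h, sum_smul]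

lemma gram_mul_gram (r : Matrix (Fin 1) (Fin 3) H) :
    (rᴴ * r) * (rᴴ * r) = (∑ u, ‖r 0 u‖ ^ 2) • (rᴴ * r) := by
  rw [Matrix.mul_assoc, ← Matrix.mul_assoc r, row_mul_conjTranspose, smul_mul, Matrix.one_mul,
    Matrix.mul_smul]

lemma one_add_smul_mul_one_add_smul {P : Matrix (Fin 3) (Fin 3) H} {s : ℝ} (hP : P * P = s • P)
    (p q : ℝ) : (1 + p • P) * (1 + q • P) = 1 + (p + q + p * q * s) • P := by
  rw [add_mul, mul_add, mul_add, smul_mul_smul_comm, hP, one_mul, one_mul, mul_one, smul_smul]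
  module

/-- `P = rᴴr` satisfies `P² = sP`, so the matrices `1 + pP` are closed under products. With `q = √(1
- s)`, the coefficient `1/(q(1 + q))` makes `1 + ps = 1/q`, as an inverse square root of `1 - P`
requires. -/
lemma exists_isPosInvSqrt {r : Matrix (Fin 1) (Fin 3) H} (hr : ∑ u, ‖r 0 u‖ ^ 2 < 1) :
    ∃ D, IsPosInvSqrt (1 - rᴴ * r) D := by
  set s := ∑ u, ‖r 0 u‖ ^ 2 with hs
  set q := Real.sqrt (1 - s) with hq
  have hq0 : 0 < q := Real.sqrt_pos.2 (by linarith)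
  have hq2 : q ^ 2 = 1 - s := Real.sq_sqrt (by linarith)
  have hM : 1 - rᴴ * r = 1 + (-1 : ℝ) • (rᴴ * r) := by module
  have hP := gram_mul_gram r
  have hs' : s = 1 - q ^ 2 := by linarith
  refine ⟨1 + (1 / (q * (1 + q))) • (rᴴ * r), hM ▸ qPosDef_one_add_gram hr le_rfl,
    qPosDef_one_add_gram hr (le_trans (by norm_num) (by positivity : (0 : ℝ) ≤ 1 / (q * (1 + q)))),
    ?_, ?_⟩
  · rw [hM, one_add_smul_mul_one_add_smul hP, one_add_smul_mul_one_add_smul hP, ← hs, hs']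
    convert! add_zero (1 : Matrix (Fin 3) (Fin 3) H) using 2
    convert! zero_smul ℝ (rᴴ * r) using 2
    field_simp
    ring
  · rw [hM, one_add_smul_mul_one_add_smul hP, one_add_smul_mul_one_add_smul hP, ← hs, hs']
    convert! add_zero (1 : Matrix (Fin 3) (Fin 3) H) using 2
    convert! zero_smul ℝ (rᴴ * r) using 2
    field_simp
    ring

lemma exists_isPosSqrt {r : Matrix (Fin 1) (Fin 3) H} (hr : ∑ u, ‖r 0 u‖ ^ 2 < 1) :
    ∃ S, IsPosSqrt (1 - r * rᴴ) S := by
  have h : 1 - r * rᴴ = (1 - ∑ u, ‖r 0 u‖ ^ 2) • (1 : Matrix (Fin 1) (Fin 1) H) := by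
    rw [row_mul_conjTranspose]
    module
  have h0 : 0 < 1 - ∑ u, ‖r 0 u‖ ^ 2 := by linarith
  refine ⟨Real.sqrt (1 - ∑ u, ‖r 0 u‖ ^ 2) • 1, h ▸ qPosDef_smul_one h0,
    qPosDef_smul_one (Real.sqrt_pos.2 h0), ?_⟩
  rw [smul_mul_smul_comm, one_mul, Real.mul_self_sqrt h0.le, h]

/-- A Hermitian `1 × 1` matrix has a real entry, so the left factor of `B` is central. -/
lemma IsPosSqrt.exists_real {r : Matrix (Fin 1) (Fin 3) H} {S : Matrix (Fin 1) (Fin 1) H}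
    (h : IsPosSqrt (1 - r * rᴴ) S) :
    ∃ t : ℝ, S 0 0 = (t : H) ∧ t ^ 2 = 1 - ∑ u, ‖r 0 u‖ ^ 2 := by
  have h1 : star (S 0 0) = S 0 0 := congrFun (congrFun h.2.1.1 0) 0
  obtain ⟨t, ht⟩ : ∃ t : ℝ, S 0 0 = (t : H) := ⟨(S 0 0).re, (Quaternion.star_eq_self.1 h1)⟩
  refine ⟨t, ht, ?_⟩
  have h2 := congrFun (congrFun h.2.2 0) 0
  rw [row_mul_conjTranspose, Matrix.mul_apply] at h2
  simp only [univ_unique, Fin.default_eq_zero, sum_singleton, ht, Matrix.sub_apply,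
    Matrix.smul_apply, Matrix.one_apply_eq] at h2
  have h3 := congrArg reL h2
  rw [map_sub, map_smul] at h3
  have h4 : (1 : H).re = 1 := rfl
  simp only [reL_apply, h4, smul_eq_mul, mul_one, ← Quaternion.coe_mul, Quaternion.re_coe] at h3
  rw [sq, h3]

lemma IsPosInvSqrt.sum_norm_sq {r : Matrix (Fin 1) (Fin 3) H} {D : Matrix (Fin 3) (Fin 3) H}
    (h : IsPosInvSqrt (1 - rᴴ * r) D) (c : Fin 3 → H) :
    ∑ u, ‖(D *ᵥ c) u‖ ^ 2 - ‖∑ u, r 0 u * (D *ᵥ c) u‖ ^ 2 = ∑ u, ‖c u‖ ^ 2 := by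
  obtain ⟨-, ⟨hD, -⟩, h1, h2⟩ := h
  have hM : 1 - rᴴ * r = 1 + (-1 : ℝ) • (rᴴ * r) := by module
  -- `D` commutes with `M = 1 - rᴴr` because `D²` is a two-sided inverse of `M`; then `DMD = 1`,
  -- which turns the defect form at `Dc` into `∑‖cᵤ‖²`.
  have hX : D * (1 - rᴴ * r) = (1 - rᴴ * r) * D := by
    calc D * (1 - rᴴ * r) = (1 - rᴴ * r) * (D * D) * (D * (1 - rᴴ * r)) := by rw [h2, one_mul]
      _ = (1 - rᴴ * r) * D * (D * D * (1 - rᴴ * r)) := by simp only [Matrix.mul_assoc]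
      _ = (1 - rᴴ * r) * D := by rw [h1, mul_one]
  have hDMD : Dᴴ * ((1 - rᴴ * r) * D) = 1 := by
    rw [hD.eq, ← hX, ← Matrix.mul_assoc, h1]
  have h3 := star_dotProduct_one_add_gram_re r (-1) (D *ᵥ c)
  rw [← hM, mulVec_mulVec, star_mulVec, ← dotProduct_mulVec, mulVec_mulVec, hDMD, one_mulVec,
    star_dotProduct_self_re] at h3
  linarith

/-! ### The main results -/

lemma muRow_apply (x : H) (i : Fin 1) (u : Fin 3) : muRow x i u = mu u x := rfl

lemma Omega1_sum_lt {a : H} (ha : a ∈ Omega1) : ∑ u, ‖muRow a 0 u‖ ^ 2 < 1 := ha.2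

theorem isStrictlyContractiveMultiplier_muRow {a : H} (ha : a ∈ Omega1) :
    IsStrictlyContractiveMultiplier (fun _ => muRow a) := by
  have hs0 : 0 ≤ ∑ u, ‖mu u a‖ ^ 2 := by positivity
  refine ⟨Real.sqrt (∑ u, ‖mu u a‖ ^ 2), Real.sqrt_nonneg _,
    (Real.sqrt_lt' one_pos).2 (by simpa using ha.2), fun f c hf => ?_⟩
  have hle : ∀ α, weight α * ‖∑ u, mu u a * c u α‖ ^ 2
      ≤ (∑ u, ‖mu u a‖ ^ 2) * ∑ u, weight α * ‖c u α‖ ^ 2 := fun α => by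
    rw [← mul_sum, mul_left_comm]
    exact mul_le_mul_of_nonneg_left (norm_sum_mul_sq_le _ _) (weight_pos α).le
  have hsum : Summable fun α => (∑ u, ‖mu u a‖ ^ 2) * ∑ u, weight α * ‖c u α‖ ^ 2 :=
    (summable_sum fun u _ => (hf u).sq_summable).mul_left _
  have hd : Summable fun α => weight α * ‖∑ u, mu u a * c u α‖ ^ 2 :=
    Summable.of_nonneg_of_le (fun α => mul_nonneg (weight_pos α).le (sq_nonneg _)) hle hsum
  have hser := hasArvesonSeries_tsum hd
  refine ⟨fun x => Matrix.of fun _ _ => ∑' α, muPow α x * ∑ u, mu u a * c u α,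
    fun _ α => ∑ u, mu u a * c u α, ⟨fun i j => vqRegularOn_const _, fun i j => ?_,
      fun i j => hser.vqRegularOn, fun x hx hx0 => ?_⟩, fun i => hser, ?_⟩
  · rw [Subsingleton.elim j 0]
    exact (hf i).vqRegularOn
  · beta_reduce
    ext1 i j
    rw [Subsingleton.elim j 0, Matrix.mul_apply, Matrix.of_apply]
    exact (hasSum_finset_sum fun u => hasSum_const_mul hx0 (mu u a) ((hf u).hasSum x hx)).tsum_eq
  · simp only [normSqVec, normSq, univ_unique, sum_singleton]
    rw [Real.sq_sqrt hs0, ← Summable.tsum_finsetSum fun u _ => (hf u).sq_summable, ← tsum_mul_left]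
    exact hd.tsum_le_tsum hle hsum

lemma matVqRegularOn_one_sub (a : H) :
    MatVqRegularOn (fun x => 1 - muRow x * (muRow a)ᴴ) OmegaA := by
  intro i j
  simp only [Matrix.sub_apply, Matrix.mul_apply]
  exact (vqRegularOn_const _).sub (vqRegularOn_sum _ fun u _ => (vqRegularOn_mu u).mul_const _)

lemma matVqRegularOn_muRow_sub (a : H) : MatVqRegularOn (fun x => muRow x - muRow a) OmegaA :=
  fun _ u => (vqRegularOn_mu u).sub (vqRegularOn_const _)

lemma matVqRegularOn_const {n m : ℕ} (C : Matrix (Fin n) (Fin m) H) :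
    MatVqRegularOn (fun _ => C) OmegaA := fun _ _ => vqRegularOn_const _

lemma one_sub_apply (x a : H) :
    (1 - muRow x * (muRow a)ᴴ : Matrix (Fin 1) (Fin 1) H) 0 0 = 1 - ∑ u, mu u x * star (mu u a) := rfl

lemma exists_isStarInverse {a : H} (ha : a ∈ Omega1) :
    ∃ R, IsStarInverse (fun x => 1 - muRow x * (muRow a)ᴴ) R ∧ MatVqRegularOn R OmegaA := by
  have hser := hasArvesonSeries_tsum (summable_invCoeff ha.2)
  set R : H → Matrix (Fin 1) (Fin 1) H := fun x =>
    Matrix.of fun _ _ => ∑' α, muPow α x * invCoeff (fun u => mu u a) α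
  have hreg : MatVqRegularOn R OmegaA := fun _ _ => hser.vqRegularOn
  have hone := matVqRegularOn_const (1 : Matrix (Fin 1) (Fin 1) H)
  have h1 : ∀ x ∈ OmegaA, x.re = 0 →
      (1 - ∑ u, mu u x * star (mu u a)) * R x 0 0 = 1 := fun x hx hx0 =>
    invCoeff_functional_equation _ hx0 (hser.hasSum x hx)
  have key : ∀ A B : Matrix (Fin 1) (Fin 1) H, A 0 0 * B 0 0 = 1 → 1 = A * B := by
    intro A B h
    ext1 i j
    rw [Subsingleton.elim i 0, Subsingleton.elim j 0, Matrix.mul_apply]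
    simp [h]
  refine ⟨R, ⟨⟨matVqRegularOn_one_sub a, hreg, hone, fun x hx hx0 => key _ _ (h1 x hx hx0)⟩,
    ⟨hreg, matVqRegularOn_one_sub a, hone, fun x hx hx0 => key _ _ ?_⟩⟩, hreg⟩
  -- One-sided inverses are two-sided in a division ring.
  exact mul_eq_one_symm (h1 x hx hx0)

/-- Works for an arbitrary `⋆`-inverse, so the Schur property needs no uniqueness of CK-extensions:
values on `x₀ = 0` suffice. -/
lemma IsStarInverse.eq_mul {a : H} {R : H → Matrix (Fin 1) (Fin 1) H}
    (hR : IsStarInverse (fun x => 1 - muRow x * (muRow a)ᴴ) R) {x : H} (hx : x ∈ OmegaA)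
    (hx0 : x.re = 0) {G q : H} (h : (1 - ∑ u, mu u x * star (mu u a)) * G = q) :
    G = R x 0 0 * q := by
  have h1 := congrFun (congrFun (hR.2.2.2.2 x hx hx0) 0) 0
  beta_reduce at h1
  rw [mul_apply_fin_one, one_sub_apply, Matrix.one_apply_eq] at h1
  rw [← h, ← mul_assoc, ← h1, one_mul]

lemma summable_weight_single (q : H) :
    Summable fun α => weight α * ‖Pi.single (M := fun _ => H) 0 q α‖ ^ 2 :=
  summable_of_ne_finset_zero (s := {0}) fun α hα => by
    rw [Pi.single_eq_of_ne (by simpa using hα)]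
    simp

lemma summable_mobius_defect (a : Fin 3 → H) {h : Fin 3 → (Fin 3 → ℕ) → H}
    (hs : ∀ u, Summable fun α => weight α * ‖h u α‖ ^ 2) :
    Summable fun α => weight α * (∑ u, ‖h u α‖ ^ 2 - ‖∑ u, a u * h u α‖ ^ 2) := by
  have h1 : Summable fun α => ∑ u, weight α * ‖h u α‖ ^ 2 := summable_sum fun u _ => hs u
  simp only [mul_sub, mul_sum]
  refine h1.sub (Summable.of_nonneg_of_le
    (fun α => mul_nonneg (weight_pos α).le (sq_nonneg _)) (fun α => ?_)
    (h1.mul_left (∑ u, ‖a u‖ ^ 2)))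
  rw [← mul_sum, mul_left_comm]
  exact mul_le_mul_of_nonneg_left (norm_sum_mul_sq_le _ _) (weight_pos α).le

theorem exists_isBlaschkeFactor {a : H} (ha : a ∈ Omega1) : ∃ B, IsBlaschkeFactor a B := by
  obtain ⟨S, hS⟩ := exists_isPosSqrt (Omega1_sum_lt ha)
  obtain ⟨D, hD⟩ := exists_isPosInvSqrt (Omega1_sum_lt ha)
  obtain ⟨R, hR, hreg⟩ := exists_isStarInverse ha
  -- The columns of `N` are obtained by applying the Möbius construction to the constant basis
  -- vectors.
  let h : Fin 3 → Fin 3 → (Fin 3 → ℕ) → H := fun j u => Pi.single 0 (if u = j then 1 else 0)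
  have hser : ∀ j, HasArvesonSeries
      (fun x => ∑' α, muPow α x * mobiusCoeff (fun u => mu u a) (h j) α)
      (mobiusCoeff (fun u => mu u a) (h j)) := fun j =>
    hasArvesonSeries_tsum (mobiusCoeff_bound ha.2 (fun _ => rfl) (fun α => by
      have h1 := norm_sum_mul_sq_le (fun u => mu u a) (fun u => h j u α)
      have h2 : 0 ≤ ∑ u, ‖h j u α‖ ^ 2 := by positivity
      nlinarith [ha.2]) (summable_mobius_defect _ fun u => summable_weight_single _)).1
  refine ⟨_, S, R, fun x => Matrix.of fun _ j =>
    ∑' α, muPow α x * mobiusCoeff (fun u => mu u a) (h j) α, D, hS, hD, hR,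
    ⟨hreg, matVqRegularOn_muRow_sub a, fun _ j => (hser j).vqRegularOn, fun x hx hx0 => ?_⟩,
    fun x _ => rfl⟩
  beta_reduce
  ext1 i j
  rw [Subsingleton.elim i 0, Matrix.mul_apply, Matrix.of_apply]
  have h1 := hR.eq_mul hx hx0 (mobiusCoeff_functional_equation (fun u => mu u a) hx0
    ((hser j).hasSum x hx) fun u => hasSum_single x _)
  simpa [muRow_apply] using h1

theorem IsBlaschkeFactor.isSchurMultiplier {a : H} (ha : a ∈ Omega1)
    {B : H → Matrix (Fin 1) (Fin 3) H} (hB : IsBlaschkeFactor a B) : IsSchurMultiplier B := by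
  obtain ⟨S, R, N, D, hS, hD, hR, hN, hBx⟩ := hB
  obtain ⟨t, hSt, ht⟩ := hS.exists_real
  simp only [muRow_apply] at ht
  intro f c hf
  set h : Fin 3 → (Fin 3 → ℕ) → H := fun u α => (D *ᵥ fun v => c v α) u
  have hφ : ∀ α, ∑ u, ‖h u α‖ ^ 2 - ‖∑ u, mu u a * h u α‖ ^ 2 = ∑ u, ‖c u α‖ ^ 2 := fun α =>
    hD.sum_norm_sq fun v => c v α
  have hcs : Summable fun α => weight α * ∑ u, ‖c u α‖ ^ 2 := by
    simp only [mul_sum]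
    exact summable_sum fun u _ => (hf u).sq_summable
  obtain ⟨hg, hgle⟩ := mobiusCoeff_bound ha.2 hφ (fun α => by positivity) hcs
  set g := mobiusCoeff (fun u => mu u a) h
  have hnorm : ∀ α, weight α * ‖(t : H) * g α‖ ^ 2 = t ^ 2 * (weight α * ‖g α‖ ^ 2) := fun α => by
    rw [norm_mul, Quaternion.norm_coe, mul_pow, Real.norm_eq_abs, sq_abs]
    ring
  have hd : Summable fun α => weight α * ‖(t : H) * g α‖ ^ 2 := by
    simp only [hnorm]
    exact hg.mul_left _
  have hser := hasArvesonSeries_tsum hd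
  have hgser := hasArvesonSeries_tsum hg
  -- Regularity is preserved by constant right factors; the left factor `S` is the real number `t`,
  -- so it can be moved to the right.
  have hBreg : MatVqRegularOn B OmegaA := by
    intro i j
    have h1 : VqRegularOn (fun x => ∑ k, N x 0 k * ((t : H) * D k j)) OmegaA :=
      vqRegularOn_sum _ fun k _ => (hN.2.2.1 0 k).mul_const _
    refine h1.congr fun x hx => ?_
    rw [hBx x hx, Subsingleton.elim i 0, Matrix.mul_apply]
    refine sum_congr rfl fun k _ => ?_
    rw [mul_apply_fin_one, hSt, Quaternion.coe_commutes, mul_assoc]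
  refine ⟨fun x => Matrix.of fun _ _ => ∑' α, muPow α x * ((t : H) * g α),
    fun _ α => (t : H) * g α, ⟨hBreg, fun i j => ?_, fun i j => hser.vqRegularOn,
      fun x hx hx0 => ?_⟩, fun i => hser, ?_⟩
  · rw [Subsingleton.elim j 0]
    exact (hf i).vqRegularOn
  · have hhs : ∀ u, HasSum (fun α => muPow α x * h u α) ((D * f x) u 0) := fun u =>
      hasSum_finset_sum fun v => hasSum_const_mul hx0 (D u v) ((hf v).hasSum x hx)
    have h1 := hR.eq_mul hx hx0 (mobiusCoeff_functional_equation (fun u => mu u a) hx0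
      (hgser.hasSum x hx) hhs)
    have h2 := (hasSum_const_mul hx0 (t : H) (hgser.hasSum x hx)).tsum_eq
    have h3 : B x * f x = S * (R x * ((muRow x - muRow a) * (D * f x))) := by
      rw [hBx x hx, hN.2.2.2 x hx hx0]
      simp only [Matrix.mul_assoc]
    beta_reduce
    ext1 i j
    rw [Subsingleton.elim i 0, Subsingleton.elim j 0, h3, Matrix.of_apply, h2, h1]
    rw [mul_apply_fin_one, mul_apply_fin_one, hSt, Matrix.mul_apply]
    rfl
  · have h1 : ∑' α, weight α * ∑ u, ‖c u α‖ ^ 2 = normSqVec c := by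
      simp only [mul_sum]
      exact Summable.tsum_finsetSum fun u _ => (hf u).sq_summable
    simp only [normSqVec, univ_unique, sum_singleton]
    rw [normSq, tsum_congr hnorm, tsum_mul_left, ht]
    rw [h1] at hgle
    simpa [normSqVec, normSq] using hgle

end

end VqArveson

theorem mainTheorem6 (a : VqArveson.H) (ha : a ∈ VqArveson.Omega1) :
    VqArveson.IsStrictlyContractiveMultiplier (fun _ => VqArveson.muRow a) ∧
    (∃ B : VqArveson.H → Matrix (Fin 1) (Fin 3) VqArveson.H, VqArveson.IsBlaschkeFactor a B) ∧
    (∀ B : VqArveson.H → Matrix (Fin 1) (Fin 3) VqArveson.H,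
      VqArveson.IsBlaschkeFactor a B → VqArveson.IsSchurMultiplier B) :=
  ⟨VqArveson.isStrictlyContractiveMultiplier_muRow ha, VqArveson.exists_isBlaschkeFactor ha,
    fun _ hB => hB.isSchurMultiplier ha⟩
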